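/- Let $Q$ be a smooth $n$-dimensional manifold, let $k\ge 0$, and let $T^1_kQ = TQ\oplus\overset{k}{\cdots}\oplus TQ$ be the Whitney sum of $k$ copies of $TQ$, with natural coordinates $(q^i,v^i_A)$. For a vector field $Z=Z^i\,\partial/\partial q^i$ on $Q$ and $1\le A\le k$, let $Z^C$ denote its complete lift to $T^1_kQ$ (the vector field generated by the prolonged local flow $(v_1,\dots,v_k)\mapsto((h_s)_*v_1,\dots,(h_s)_*v_k)$ of $Z$, locally $Z^C=Z^i\frac{\partial}{\partial q^i}+v^j_A\frac{\partial Z^i}{\partial q^j}\frac{\partial}{\partial v^i_A}$), and let $Z^{V_A}$ denote its vertical $A$-lift, $Z^{V_A}(v_1,\dots,v_k)=\frac{d}{ds}\big|_{s=0}(v_1,\dots,v_A+sZ,\dots,v_k)$, locally $Z^{V_A}=Z^i\frac{\partial}{\partial v^i_A}$. For a smooth map $\phi$ from an open set $U\subseteq\mathbb R^k$ to $Q$, let $\phi^{(1)}=\big(\phi_*\frac{\partial}{\partial t^1},\dots,\phi_*\frac{\partial}{\partial t^k}\big):U\to T^1_kQ$ be its first prolongation. **Theorem (Lagrangian Noether).**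 Let $L:T^1_kQ\to\mathbb R$ be a smooth Lagrangian, and let $Y=Z^C$, with $Z$ a smooth vector field on $Q$, be an infinitesimal natural Lagrangian strict symmetry, that is, $Z^C(L)=0$. Then the functions $f^A=Z^{V_A}(L)$, $1\le A\le k$, define a conservation law $f=(f^1,\dots,f^k):T^1_kQ\to\mathbb R^k$ for the Euler–Lagrange equations $$\sum_{A=1}^k\frac{\partial}{\partial t^A}\Big(\frac{\partial L}{\partial v^i_A}\circ\phi^{(1)}\Big)=\frac{\partial L}{\partial q^i}\circ\phi^{(1)},\qquad 1\le i\le n:$$ each $f^A$ is smooth and, for every open $U\subseteq\mathbb R^k$ and every smooth solution $\phi:U\to Q$ of these equations (in particular for every solution on $U=\mathbb R^k$), $$\sum_{A=1}^k\frac{\partial (f^A\circ\phi^{(1)})}{\partial t^A}=0\quad\text{on }U.$$ -/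

import Mathlib

open Bundle Set Filter Topology
open scoped Manifold ContDiff

noncomputable section

namespace KSymplectic

/-! ### The tangent bundle of `k¹`-velocities -/

/-- A linear endomorphism acting on each of the `k` components, as a continuous linear function of
that endomorphism. -/
def diagonalMap (n k : ℕ) :
    (EuclideanSpace ℝ (Fin n) →L[ℝ] EuclideanSpace ℝ (Fin n)) →L[ℝ]
      ((Fin k → EuclideanSpace ℝ (Fin n)) →L[ℝ] (Fin k → EuclideanSpace ℝ (Fin n))) :=
  LinearMap.toContinuousLinearMap
    { toFun := fun f => ContinuousLinearMap.piMap fun _ : Fin k => f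
      map_add' := fun _ _ => rfl
      map_smul' := fun _ _ => rfl }

/-- The fibre over `q` of the Whitney sum of `k` copies of `TQ`: the `k`-tuples
`(v₁, …, v_k)` of tangent vectors at `q`. -/
def VelocityFiber (n k : ℕ) {Q : Type*} [TopologicalSpace Q]
    [ChartedSpace (EuclideanSpace ℝ (Fin n)) Q] (q : Q) : Type :=
  Fin k → TangentSpace (𝓡 n) q

/-- The vector bundle core of the Whitney sum `TQ ⊕ ⋯ ⊕ TQ` (`k` copies): the coordinate changes
are those of `TQ`, acting on each of the `k` components. -/
def velocityCore (n k : ℕ) (Q : Type*) [TopologicalSpace Q]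
    [ChartedSpace (EuclideanSpace ℝ (Fin n)) Q] [IsManifold (𝓡 n) ∞ Q] :
    VectorBundleCore ℝ Q (Fin k → EuclideanSpace ℝ (Fin n))
      (atlas (EuclideanSpace ℝ (Fin n)) Q) where
  baseSet := (tangentBundleCore (𝓡 n) Q).baseSet
  isOpen_baseSet := (tangentBundleCore (𝓡 n) Q).isOpen_baseSet
  indexAt := (tangentBundleCore (𝓡 n) Q).indexAt
  mem_baseSet_at := (tangentBundleCore (𝓡 n) Q).mem_baseSet_at
  coordChange i j x := diagonalMap n k ((tangentBundleCore (𝓡 n) Q).coordChange i j x)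
  coordChange_self i x hx v := by
    funext A
    exact (tangentBundleCore (𝓡 n) Q).coordChange_self i x hx (v A)
  continuousOn_coordChange i j :=
    (diagonalMap n k).continuous.comp_continuousOn
      ((tangentBundleCore (𝓡 n) Q).continuousOn_coordChange i j)
  coordChange_comp i j l x hx v := by
    funext A
    exact (tangentBundleCore (𝓡 n) Q).coordChange_comp i j l x hx (v A)

section Instances

variable {n k : ℕ} {Q : Type*} [TopologicalSpace Q]
  [ChartedSpace (EuclideanSpace ℝ (Fin n)) Q]

instance (q : Q) : TopologicalSpace (VelocityFiber n k q) :=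
  inferInstanceAs (TopologicalSpace (Fin k → TangentSpace (𝓡 n) q))

instance (q : Q) : AddCommGroup (VelocityFiber n k q) :=
  inferInstanceAs (AddCommGroup (Fin k → TangentSpace (𝓡 n) q))

instance (q : Q) : Module ℝ (VelocityFiber n k q) :=
  inferInstanceAs (Module ℝ (Fin k → TangentSpace (𝓡 n) q))

variable [IsManifold (𝓡 n) ∞ Q]

instance : (velocityCore n k Q).IsContMDiff (𝓡 n) ∞ where
  contMDiffOn_coordChange i j :=
    haveI : IsManifold (𝓡 n) (∞ + 1) Q := ‹IsManifold (𝓡 n) ∞ Q›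
    haveI : (tangentBundleCore (𝓡 n) Q).IsContMDiff (𝓡 n) ∞ := tangentBundleCore.isContMDiff
    (diagonalMap n k).contMDiff.comp_contMDiffOn
      ((tangentBundleCore (𝓡 n) Q).contMDiffOn_coordChange (𝓡 n) i j)

end Instances

/-- `T¹ₖQ`, the Whitney sum of `k` copies of `TQ`. -/
abbrev Velocities (n k : ℕ) (Q : Type*) [TopologicalSpace Q]
    [ChartedSpace (EuclideanSpace ℝ (Fin n)) Q] : Type _ :=
  TotalSpace (Fin k → EuclideanSpace ℝ (Fin n)) (VelocityFiber n k : Q → Type)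

/-- The model with corners of the smooth manifold `T¹ₖQ`. -/
abbrev velocityModel (n k : ℕ) :
    ModelWithCorners ℝ (EuclideanSpace ℝ (Fin n) × (Fin k → EuclideanSpace ℝ (Fin n)))
      (ModelProd (EuclideanSpace ℝ (Fin n)) (Fin k → EuclideanSpace ℝ (Fin n))) :=
  (𝓡 n).prod 𝓘(ℝ, Fin k → EuclideanSpace ℝ (Fin n))

section Instances

variable {n k : ℕ} {Q : Type*} [TopologicalSpace Q]
  [ChartedSpace (EuclideanSpace ℝ (Fin n)) Q] [IsManifold (𝓡 n) ∞ Q]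

instance : TopologicalSpace (Velocities n k Q) :=
  inferInstanceAs (TopologicalSpace (velocityCore n k Q).TotalSpace)

instance : FiberBundle (Fin k → EuclideanSpace ℝ (Fin n)) (VelocityFiber n k : Q → Type) :=
  inferInstanceAs
    (FiberBundle (Fin k → EuclideanSpace ℝ (Fin n)) (velocityCore n k Q).Fiber)

instance : VectorBundle ℝ (Fin k → EuclideanSpace ℝ (Fin n)) (VelocityFiber n k : Q → Type) :=
  inferInstanceAs
    (VectorBundle ℝ (Fin k → EuclideanSpace ℝ (Fin n)) (velocityCore n k Q).Fiber)

instance : ContMDiffVectorBundle ∞ (Fin k → EuclideanSpace ℝ (Fin n))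
    (VelocityFiber n k : Q → Type) (𝓡 n) :=
  (velocityCore n k Q).instContMDiffVectorBundle

end Instances

section Notions

variable {n k : ℕ} {Q : Type*} [TopologicalSpace Q]
  [ChartedSpace (EuclideanSpace ℝ (Fin n)) Q]

/-! ### Natural coordinates -/

/-- The natural coordinates `(qⁱ, vⁱ_A)` on `T¹ₖQ` induced by a chart `e` of `Q`. -/
def naturalCoords (e : OpenPartialHomeomorph Q (EuclideanSpace ℝ (Fin n)))
    (w : Velocities n k Q) :
    EuclideanSpace ℝ (Fin n) × (Fin k → EuclideanSpace ℝ (Fin n)) :=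
  (e w.proj, fun A => mfderiv (𝓡 n) (𝓡 n) e w.proj (w.snd A))

/-- The point of `T¹ₖQ` with given natural coordinates `(qⁱ, vⁱ_A)` with respect to a chart `e`
of `Q`; here `v_A = vⁱ_A ∂/∂qⁱ`. -/
def naturalPoint (e : OpenPartialHomeomorph Q (EuclideanSpace ℝ (Fin n)))
    (x : EuclideanSpace ℝ (Fin n) × (Fin k → EuclideanSpace ℝ (Fin n))) :
    Velocities n k Q :=
  ⟨e.symm x.1, fun A => mfderiv (𝓡 n) (𝓡 n) e.symm x.1 (x.2 A)⟩

/-- The partial derivative `∂L/∂qⁱ` in the natural coordinates induced by `e`. -/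
def partialQ (e : OpenPartialHomeomorph Q (EuclideanSpace ℝ (Fin n)))
    (L : Velocities n k Q → ℝ) (i : Fin n) (w : Velocities n k Q) : ℝ :=
  fderiv ℝ (fun x => L (naturalPoint e x)) (naturalCoords e w)
    (EuclideanSpace.single i 1, 0)

/-- The partial derivative `∂L/∂vⁱ_A` in the natural coordinates induced by `e`. -/
def partialV (e : OpenPartialHomeomorph Q (EuclideanSpace ℝ (Fin n)))
    (L : Velocities n k Q → ℝ) (A : Fin k) (i : Fin n) (w : Velocities n k Q) : ℝ :=
  fderiv ℝ (fun x => L (naturalPoint e x)) (naturalCoords e w)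
    (0, Pi.single A (EuclideanSpace.single i 1))

/-! ### Field equations and conservation laws -/

/-- The first prolongation `φ⁽¹⁾(t) = (φ_*(t)(∂/∂t¹), …, φ_*(t)(∂/∂tᵏ))`. -/
def prolongation (φ : EuclideanSpace ℝ (Fin k) → Q) (t : EuclideanSpace ℝ (Fin k)) :
    Velocities n k Q :=
  ⟨φ t, fun A => mfderiv (𝓡 k) (𝓡 n) φ t (EuclideanSpace.single A (1 : ℝ))⟩

/-- The canonical prolongation `T¹ₖφ(v₁, …, v_k) = (φ_* v₁, …, φ_* v_k)` of a map `φ : Q → Q`. -/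
def canonicalProlongation (φ : Q → Q) (w : Velocities n k Q) : Velocities n k Q :=
  ⟨φ w.proj, fun A => mfderiv (𝓡 n) (𝓡 n) φ w.proj (w.snd A)⟩

variable [IsManifold (𝓡 n) ∞ Q]

/-- `φ` is, on the open set `U ⊆ ℝᵏ`, a smooth solution of the Euler–Lagrange equations
`∑_A ∂/∂t^A (∂L/∂vⁱ_A ∘ φ⁽¹⁾) = ∂L/∂qⁱ ∘ φ⁽¹⁾` in all local coordinates of `Q`. -/
structure IsEulerLagrangeSolutionOn (L : Velocities n k Q → ℝ)
    (φ : EuclideanSpace ℝ (Fin k) → Q) (U : Set (EuclideanSpace ℝ (Fin k))) : Prop where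
  smooth : ContMDiffOn (𝓡 k) (𝓡 n) ∞ φ U
  equations : ∀ e ∈ IsManifold.maximalAtlas (𝓡 n) ∞ Q, ∀ t ∈ U, φ t ∈ e.source → ∀ i : Fin n,
    ∑ A : Fin k, fderiv ℝ (fun s => partialV e L A i (prolongation φ s)) t
        (EuclideanSpace.single A 1)
      = partialQ e L i (prolongation φ t)

/-- `F = (F¹, …, Fᵏ) : T¹ₖQ → ℝᵏ` is a conservation law for the Euler–Lagrange equations of `L`:
it is smooth, and `∑_A ∂(F^A ∘ φ⁽¹⁾)/∂t^A = 0` for every solution `φ`, whether it is defined on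
`ℝᵏ` or only on an open subset of `ℝᵏ`. -/
structure IsConservationLaw (L : Velocities n k Q → ℝ) (F : Fin k → Velocities n k Q → ℝ) :
    Prop where
  smooth : ∀ A, ContMDiff (velocityModel n k) 𝓘(ℝ, ℝ) ∞ (F A)
  divergence_eq_zero : ∀ (U : Set (EuclideanSpace ℝ (Fin k))), IsOpen U →
    ∀ φ : EuclideanSpace ℝ (Fin k) → Q, IsEulerLagrangeSolutionOn L φ U →
      ∀ t ∈ U, ∑ A : Fin k, fderiv ℝ (fun s => F A (prolongation φ s)) t
        (EuclideanSpace.single A 1) = 0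

/-! ### Lifts of vector fields and symmetries -/

/-- The derivative `Y(f)` of a function `f` on `T¹ₖQ` along a vector field `Y` on `T¹ₖQ`. -/
def lieDerivative (Y : ∀ w : Velocities n k Q, TangentSpace (velocityModel n k) w)
    (f : Velocities n k Q → ℝ) (w : Velocities n k Q) : ℝ :=
  mfderiv (velocityModel n k) 𝓘(ℝ, ℝ) f w (Y w)

/-- The vertical `A`-lift `Z^{V_A}` of a vector field `Z` on `Q`: the velocity at `s = 0` of the
curve `s ↦ (v₁, …, v_A + s Z_q, …, v_k)`. -/
def verticalLift (Z : ∀ q : Q, TangentSpace (𝓡 n) q) (A : Fin k) (w : Velocities n k Q) :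
    TangentSpace (velocityModel n k) w :=
  mfderiv 𝓘(ℝ, ℝ) (velocityModel n k)
    (fun s : ℝ => (⟨w.proj, Function.update w.snd A (w.snd A + s • Z w.proj)⟩ : Velocities n k Q)) 0 (1 : ℝ)

/-- The components `Zⁱ` of a vector field `Z = Zⁱ ∂/∂qⁱ` in a chart `e`, as functions of the
coordinates. -/
def localComponents (e : OpenPartialHomeomorph Q (EuclideanSpace ℝ (Fin n)))
    (Z : ∀ q : Q, TangentSpace (𝓡 n) q) (x : EuclideanSpace ℝ (Fin n)) :
    EuclideanSpace ℝ (Fin n) :=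
  mfderiv (𝓡 n) (𝓡 n) e (e.symm x) (Z (e.symm x))

/-- The complete lift `Z^C = Zⁱ ∂/∂qⁱ + vʲ_A (∂Zⁱ/∂qʲ) ∂/∂vⁱ_A` of a vector field `Z` on `Q`,
written at each point of `T¹ₖQ` in the natural coordinates of a chart around its projection. That
this is the vector field generated by the prolonged local flow of `Z` is proved below. -/
def completeLift (Z : ∀ q : Q, TangentSpace (𝓡 n) q) (w : Velocities n k Q) :
    TangentSpace (velocityModel n k) w :=
  let e := chartAt (EuclideanSpace ℝ (Fin n)) w.proj
  mfderiv 𝓘(ℝ, EuclideanSpace ℝ (Fin n) × (Fin k → EuclideanSpace ℝ (Fin n)))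
    (velocityModel n k) (naturalPoint e) (naturalCoords e w)
    (localComponents e Z (e w.proj),
      fun A => fderiv ℝ (localComponents e Z) (e w.proj) ((naturalCoords e w).2 A))

/-- `Y` is an infinitesimal strict symmetry of the Lagrangian `L`: `Y(L) = 0`. -/
def IsInfinitesimalStrictSymmetry (L : Velocities n k Q → ℝ)
    (Y : ∀ w : Velocities n k Q, TangentSpace (velocityModel n k) w) : Prop :=
  ∀ w, lieDerivative Y L w = 0

end Notions

/-! ### The complete lift and the prolonged flow -/

section Flow

variable {n k : ℕ} {Q : Type*} [TopologicalSpace Q]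
  [ChartedSpace (EuclideanSpace ℝ (Fin n)) Q] [IsManifold (𝓡 n) ∞ Q]

theorem mfderiv_chart_symm (q : Q) (x : EuclideanSpace ℝ (Fin n)) (hx : x ∈ (chartAt (EuclideanSpace ℝ (Fin n)) q).target) :
    (mfderiv (𝓡 n) (𝓡 n) (chartAt (EuclideanSpace ℝ (Fin n)) q).symm x : EuclideanSpace ℝ (Fin n) →L[ℝ] EuclideanSpace ℝ (Fin n)) =
     (tangentBundleCore (𝓡 n) Q).coordChange (achart (EuclideanSpace ℝ (Fin n)) q) (achart (EuclideanSpace ℝ (Fin n)) ((chartAt (EuclideanSpace ℝ (Fin n)) q).symm x))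
        ((chartAt (EuclideanSpace ℝ (Fin n)) q).symm x) := by
  have h := TangentBundle.symmL_trivializationAt (I := 𝓡 n) (x₀ := q)
    (x := (chartAt (EuclideanSpace ℝ (Fin n)) q).symm x) ((chartAt (EuclideanSpace ℝ (Fin n)) q).map_target hx)
  rw [TangentBundle.symmL_trivializationAt_eq_core ((chartAt (EuclideanSpace ℝ (Fin n)) q).map_target hx)] at h
  have key : ∀ y, y = x → (mfderiv (𝓡 n) (𝓡 n) (chartAt (EuclideanSpace ℝ (Fin n)) q).symm x : EuclideanSpace ℝ (Fin n) →L[ℝ] EuclideanSpace ℝ (Fin n)) =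
    (mfderiv (𝓡 n) (𝓡 n) (chartAt (EuclideanSpace ℝ (Fin n)) q).symm y : EuclideanSpace ℝ (Fin n) →L[ℝ] EuclideanSpace ℝ (Fin n)) := by rintro y rfl; rfl
  refine (key _ ((chartAt (EuclideanSpace ℝ (Fin n)) q).right_inv hx)).trans ?_
  refine Eq.trans ?_ h.symm
  simp [mfderivWithin_univ, extChartAt, OpenPartialHomeomorph.extend]
  rfl

theorem naturalPoint_eq (q : Q) (w : Velocities n k Q) (hw : w.proj = q) (x : EuclideanSpace ℝ (Fin n) × (Fin k → EuclideanSpace ℝ (Fin n)))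
    (hx : x.1 ∈ (chartAt (EuclideanSpace ℝ (Fin n)) q).target) :
    naturalPoint (chartAt (EuclideanSpace ℝ (Fin n)) q) x = (extChartAt (velocityModel n k) w).symm x := by
  subst hw
  rw [FiberBundle.extChartAt]
  simp only [mfld_simps]
  have h := mfderiv_chart_symm w.proj x.1 hx
  refine (congrArg (fun f : EuclideanSpace ℝ (Fin n) →L[ℝ] EuclideanSpace ℝ (Fin n) => (⟨(chartAt (EuclideanSpace ℝ (Fin n)) w.proj).symm x.1, fun A => f (x.2 A)⟩ : Velocities n k Q)) h).trans ?_
  rfl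

theorem naturalCoords_eq (w : Velocities n k Q) :
    naturalCoords (chartAt (EuclideanSpace ℝ (Fin n)) w.proj) w = (chartAt (EuclideanSpace ℝ (Fin n)) w.proj w.proj, w.snd) := by
  have h : (mfderiv (𝓡 n) (𝓡 n) (chartAt (EuclideanSpace ℝ (Fin n)) w.proj) w.proj : EuclideanSpace ℝ (Fin n) →L[ℝ] EuclideanSpace ℝ (Fin n)) = .id ℝ (EuclideanSpace ℝ (Fin n)) := by
    have := mfderiv_extChartAt_self (I := 𝓡 n) (x := w.proj)
    refine Eq.trans ?_ this
    simp [extChartAt, OpenPartialHomeomorph.extend]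
  refine (congrArg (fun f : EuclideanSpace ℝ (Fin n) →L[ℝ] EuclideanSpace ℝ (Fin n) => (chartAt (EuclideanSpace ℝ (Fin n)) w.proj w.proj, fun A => f (w.snd A))) h).trans ?_
  rfl

theorem mdifferentiableAt_naturalPoint (w : Velocities n k Q) :
    MDifferentiableAt 𝓘(ℝ, EuclideanSpace ℝ (Fin n) × (Fin k → EuclideanSpace ℝ (Fin n))) (velocityModel n k)
      (naturalPoint (chartAt (EuclideanSpace ℝ (Fin n)) w.proj)) (naturalCoords (chartAt (EuclideanSpace ℝ (Fin n)) w.proj) w) := by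
  have h : (extChartAt (velocityModel n k) w w) = naturalCoords (chartAt (EuclideanSpace ℝ (Fin n)) w.proj) w := by
    rw [FiberBundle.extChartAt, naturalCoords_eq]
    simp only [mfld_simps]
    have := (velocityCore n k Q).coordChange_self (achart (EuclideanSpace ℝ (Fin n)) w.proj) w.proj (mem_chart_source _ _) w.snd
    refine Prod.ext rfl ?_
    exact this
  rw [← h]
  have := mdifferentiableWithinAt_extChartAt_symm (I := velocityModel n k) (mem_extChartAt_target (I := velocityModel n k) w)
  have h2 : range (velocityModel n k) = univ := by simp [velocityModel]
  rw [h2, mdifferentiableWithinAt_univ] at this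
  refine this.congr_of_eventuallyEq ?_
  have : (extChartAt (velocityModel n k) w w) ∈ (Prod.fst ⁻¹' (chartAt (EuclideanSpace ℝ (Fin n)) w.proj).target : Set (EuclideanSpace ℝ (Fin n) × (Fin k → EuclideanSpace ℝ (Fin n)))) := by
    rw [h]
    exact mem_chart_target _ _
  filter_upwards [((chartAt (EuclideanSpace ℝ (Fin n)) w.proj).open_target.preimage continuous_fst).mem_nhds this] with x hx
  exact naturalPoint_eq _ _ rfl _ hx

theorem hasDerivAt_flow_coords (G : ℝ × EuclideanSpace ℝ (Fin n) → EuclideanSpace ℝ (Fin n)) (x₀ : EuclideanSpace ℝ (Fin n)) (X : EuclideanSpace ℝ (Fin n) → EuclideanSpace ℝ (Fin n)) (hG : ContDiffAt ℝ ∞ G (0, x₀))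
    (hX : ∀ᶠ x in 𝓝 x₀, fderiv ℝ G (0, x) (1, 0) = X x) (v : Fin k → EuclideanSpace ℝ (Fin n)) :
    HasDerivAt (fun s : ℝ => (G (s, x₀), fun A => fderiv ℝ G (s, x₀) (0, v A)))
      (X x₀, fun A => fderiv ℝ X x₀ (v A)) 0 := by
  have hs : HasDerivAt (fun s : ℝ => (s, x₀)) ((1 : ℝ), (0 : EuclideanSpace ℝ (Fin n))) 0 :=
    (hasDerivAt_id 0).prodMk (hasDerivAt_const 0 x₀)
  have hGd : DifferentiableAt ℝ G (0, x₀) := hG.differentiableAt (by simp)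
  have hG' : DifferentiableAt ℝ (fderiv ℝ G) (0, x₀) :=
    (hG.fderiv_right (m := ∞) le_rfl).differentiableAt (by simp)
  have hle : minSmoothness ℝ 2 ≤ ∞ := by
    rw [minSmoothness_of_isRCLikeNormedField]
    exact WithTop.coe_le_coe.2 le_top
  have hS : IsSymmSndFDerivAt ℝ G (0, x₀) := hG.isSymmSndFDerivAt hle
  refine HasDerivAt.prodMk ?_ ?_
  · have := hGd.hasFDerivAt.comp_hasDerivAt (0 : ℝ) hs
    rwa [hX.self_of_nhds] at this
  · rw [hasDerivAt_pi]
    intro A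
    have h1 : HasDerivAt (fun s : ℝ => fderiv ℝ G (s, x₀) (0, v A))
        (fderiv ℝ (fderiv ℝ G) (0, x₀) (1, 0) (0, v A)) 0 := by
      have h0 : HasDerivAt (fun s : ℝ => fderiv ℝ G (s, x₀))
        (fderiv ℝ (fderiv ℝ G) (0, x₀) (1, 0)) 0 := hG'.hasFDerivAt.comp_hasDerivAt (0 : ℝ) hs
      exact ((ContinuousLinearMap.apply ℝ (EuclideanSpace ℝ (Fin n)) ((0 : ℝ), v A)).hasFDerivAt.comp_hasDerivAt (0 : ℝ) h0)
    have hx : HasFDerivAt (fun x : EuclideanSpace ℝ (Fin n) => ((0 : ℝ), x)) (ContinuousLinearMap.inr ℝ ℝ (EuclideanSpace ℝ (Fin n))) x₀ :=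
      (ContinuousLinearMap.inr ℝ ℝ (EuclideanSpace ℝ (Fin n))).hasFDerivAt
    have h2 : HasFDerivAt (fun x : EuclideanSpace ℝ (Fin n) => fderiv ℝ G (0, x) (1, 0))
        ((ContinuousLinearMap.apply ℝ (EuclideanSpace ℝ (Fin n)) ((1 : ℝ), (0 : EuclideanSpace ℝ (Fin n)))).comp
        ((fderiv ℝ (fderiv ℝ G) (0, x₀)).comp (ContinuousLinearMap.inr ℝ ℝ (EuclideanSpace ℝ (Fin n))))) x₀ := by
      have h0 : HasFDerivAt (fun x : EuclideanSpace ℝ (Fin n) => fderiv ℝ G (0, x))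
        ((fderiv ℝ (fderiv ℝ G) (0, x₀)).comp (ContinuousLinearMap.inr ℝ ℝ (EuclideanSpace ℝ (Fin n)))) x₀ :=
        hG'.hasFDerivAt.comp x₀ hx
      exact (ContinuousLinearMap.apply ℝ (EuclideanSpace ℝ (Fin n)) ((1 : ℝ), (0 : EuclideanSpace ℝ (Fin n)))).hasFDerivAt.comp x₀ h0
    have h3 := (h2.congr_of_eventuallyEq (hX.mono fun x hx => hx.symm)).fderiv
    rw [h3]
    rw [hS.eq] at h1
    exact h1

theorem mdifferentiableAt_chart {q q' : Q} (h : q' ∈ (chartAt (EuclideanSpace ℝ (Fin n)) q).source) : MDifferentiableAt (𝓡 n) (𝓡 n) (chartAt (EuclideanSpace ℝ (Fin n)) q) q' :=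
  mdifferentiableAt_atlas (chart_mem_atlas _ _) h

theorem naturalPoint_naturalCoords (q : Q) (w : Velocities n k Q) (hw : w.proj ∈ (chartAt (EuclideanSpace ℝ (Fin n)) q).source) :
    naturalPoint (chartAt (EuclideanSpace ℝ (Fin n)) q) (naturalCoords (chartAt (EuclideanSpace ℝ (Fin n)) q) w) = w := by
  rcases w with ⟨q', v⟩
  simp only [] at hw
  unfold naturalPoint naturalCoords
  simp only []
  have hd := (mdifferentiable_chart (I := 𝓡 n) q).symm_comp_deriv hw
  have hd' : ∀ u : TangentSpace (𝓡 n) q', mfderiv (𝓡 n) (𝓡 n) (chartAt (EuclideanSpace ℝ (Fin n)) q).symm (chartAt (EuclideanSpace ℝ (Fin n)) q q') (mfderiv (𝓡 n) (𝓡 n) (chartAt (EuclideanSpace ℝ (Fin n)) q) q' u) = u := fun u =>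
    congrArg (fun f : EuclideanSpace ℝ (Fin n) →L[ℝ] EuclideanSpace ℝ (Fin n) => f u) hd
  have : ∀ (p : Q) (f : Fin k → EuclideanSpace ℝ (Fin n)), p = q' → (f = v) → (⟨p, f⟩ : Velocities n k Q) = ⟨q', v⟩ := by
    rintro p f rfl rfl; rfl
  exact this _ _ ((chartAt (EuclideanSpace ℝ (Fin n)) q).left_inv hw) (funext fun A => hd' (v A))

/-- The complete lift is generated by the prolonged flow: if `h_s` is the local one-parameter group
of `Z` near a point `q`, then `Z^C = d/ds T¹ₖ(h_s)|_{s = 0}` at every point of `T¹ₖQ` over `q`. -/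
theorem hasMFDerivAt_canonicalProlongation_flow (Z : ∀ q : Q, TangentSpace (𝓡 n) q) (w : Velocities n k Q)
    (h : ℝ → Q → Q)
    (hsmooth : ContMDiffAt (𝓘(ℝ, ℝ).prod (𝓡 n)) (𝓡 n) ∞ (fun p : ℝ × Q => h p.1 p.2) (0, w.proj))
    (hzero : ∀ᶠ x in 𝓝 w.proj, h 0 x = x)
    (hflow : ∀ᶠ p : ℝ × Q in 𝓝 (0, w.proj), HasMFDerivAt 𝓘(ℝ, ℝ) (𝓡 n) (fun s => h s p.2) p.1
      ((1 : ℝ →L[ℝ] ℝ).smulRight (Z (h p.1 p.2)))) :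
    HasMFDerivAt 𝓘(ℝ, ℝ) (velocityModel n k) (fun s => canonicalProlongation (h s) w) 0
      ((1 : ℝ →L[ℝ] ℝ).smulRight (completeLift Z w)) := by
  set e := chartAt (EuclideanSpace ℝ (Fin n)) w.proj with he
  set x₀ := e w.proj with hx₀
  let G : ℝ × EuclideanSpace ℝ (Fin n) → EuclideanSpace ℝ (Fin n) := fun p => e (h p.1 (e.symm p.2))
  have hmem : w.proj ∈ e.source := mem_chart_source _ _
  have hesymm : e.symm x₀ = w.proj := e.left_inv hmem
  have h00 : h 0 w.proj = w.proj := hzero.self_of_nhds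
  have hcont : ContinuousAt (fun p : ℝ × Q => h p.1 p.2) (0, w.proj) := hsmooth.continuousAt
  have hsrc : ∀ᶠ p : ℝ × Q in 𝓝 (0, w.proj), h p.1 p.2 ∈ e.source :=
    hcont.eventually_mem (by rw [h00]; exact e.open_source.mem_nhds hmem)
  have hsm : ContinuousAt e.symm x₀ := e.continuousAt_symm (mem_chart_target _ _)
  have hemb : Tendsto (fun x : EuclideanSpace ℝ (Fin n) => ((0 : ℝ), e.symm x)) (𝓝 x₀) (𝓝 (0, w.proj)) := by
    have : ContinuousAt (fun x : EuclideanSpace ℝ (Fin n) => ((0 : ℝ), e.symm x)) x₀ := continuousAt_const.prodMk hsm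
    rw [← hesymm]; exact this
  have hG : ContDiffAt ℝ ∞ G (0, x₀) := by
    rw [← contMDiffAt_iff_contDiffAt]
    have h1 : ContMDiffAt (𝓡 n) (𝓡 n) ∞ e.symm x₀ :=
      (contMDiffOn_symm_of_mem_maximalAtlas (IsManifold.chart_mem_maximalAtlas _)).contMDiffAt
        (e.open_target.mem_nhds (mem_chart_target _ _))
    have h2 : ContMDiffAt (𝓡 n) (𝓡 n) ∞ e w.proj :=
      contMDiffAt_of_mem_maximalAtlas (IsManifold.chart_mem_maximalAtlas _) (mem_chart_source _ _)
    have h3 : ContMDiffAt (𝓘(ℝ, ℝ × EuclideanSpace ℝ (Fin n))) (𝓘(ℝ, ℝ).prod (𝓡 n)) ∞ (fun p : ℝ × EuclideanSpace ℝ (Fin n) => (p.1, e.symm p.2)) (0, x₀) :=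
      (contDiff_fst.contMDiff.contMDiffAt).prodMk
        (h1.comp (I := 𝓘(ℝ, ℝ × EuclideanSpace ℝ (Fin n))) ((0 : ℝ), x₀) contDiff_snd.contMDiff.contMDiffAt)
    have h4 : ContMDiffAt (𝓘(ℝ, ℝ × EuclideanSpace ℝ (Fin n))) (𝓡 n) ∞ (fun p : ℝ × EuclideanSpace ℝ (Fin n) => h p.1 (e.symm p.2)) (0, x₀) :=
      ContMDiffAt.comp_of_eq hsmooth h3 (by simp [hesymm])
    exact ContMDiffAt.comp_of_eq h2 h4 (by simp [hesymm, h00])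
  have hGev : ∀ᶠ p in 𝓝 ((0 : ℝ), x₀), DifferentiableAt ℝ G p := by
    filter_upwards [(hG.of_le (m := 1) (WithTop.coe_le_coe.2 le_top)).eventually (by simp)] with p hp
    exact hp.differentiableAt (by simp)
  have hX : ∀ᶠ x in 𝓝 x₀, fderiv ℝ G (0, x) (1, 0) = localComponents e Z x := by
    have e1 : ∀ᶠ x in 𝓝 x₀, DifferentiableAt ℝ G (0, x) :=
      (Continuous.tendsto (by fun_prop : Continuous fun x : EuclideanSpace ℝ (Fin n) => ((0 : ℝ), x)) x₀).eventually hGev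
    have e4 : ∀ᶠ x in 𝓝 x₀, h 0 (e.symm x) = e.symm x := by
      have : Tendsto e.symm (𝓝 x₀) (𝓝 w.proj) := by rw [← hesymm]; exact hsm
      exact this.eventually hzero
    filter_upwards [e1, hemb.eventually hsrc, hemb.eventually hflow, e4] with x a1 a2 a3 a4
    have b1 : HasFDerivAt (fun s : ℝ => G (s, x)) ((fderiv ℝ G (0, x)).comp (ContinuousLinearMap.inl ℝ ℝ (EuclideanSpace ℝ (Fin n)))) 0 := by
      have c : HasFDerivAt (fun s : ℝ => (s, x)) (ContinuousLinearMap.inl ℝ ℝ (EuclideanSpace ℝ (Fin n))) 0 :=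
        hasFDerivAt_prodMk_left 0 x
      exact HasFDerivAt.comp (0 : ℝ) a1.hasFDerivAt c
    have b2 := (mdifferentiableAt_chart a2).hasMFDerivAt.comp (0 : ℝ) a3
    have b3 := b2.hasFDerivAt
    have b4 := congrArg (fun f : ℝ →L[ℝ] EuclideanSpace ℝ (Fin n) => f 1) (b1.unique b3)
    have b5 : ∀ q' : Q, q' = e.symm x → (mfderiv (𝓡 n) (𝓡 n) e q' (Z q') : EuclideanSpace ℝ (Fin n)) = localComponents e Z x := by
      rintro _ rfl; rfl
    rw [← b5 _ a4]
    have b6 : (fderiv ℝ G (0, x)) (1, 0) = (mfderiv (𝓡 n) (𝓡 n) e (h 0 (e.symm x)) ((1 : ℝ) • Z (h 0 (e.symm x))) : EuclideanSpace ℝ (Fin n)) := b4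
    rw [one_smul] at b6
    exact b6
  have key : ∀ᶠ s in 𝓝 (0 : ℝ), canonicalProlongation (h s) w =
      naturalPoint e (G (s, x₀), fun A => fderiv ℝ G (s, x₀) (0, w.snd A)) := by
    have e1 : ∀ᶠ s in 𝓝 (0 : ℝ), DifferentiableAt ℝ G (s, x₀) :=
      (Continuous.tendsto (by fun_prop : Continuous fun s : ℝ => (s, x₀)) 0).eventually hGev
    have cc : Tendsto (fun s : ℝ => (s, w.proj)) (𝓝 0) (𝓝 (0, w.proj)) :=
      Continuous.tendsto (by fun_prop : Continuous fun s : ℝ => (s, w.proj)) 0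
    have e3 : ∀ᶠ p : ℝ × Q in 𝓝 (0, w.proj), ContMDiffAt (𝓘(ℝ, ℝ).prod (𝓡 n)) (𝓡 n) 1 (fun p : ℝ × Q => h p.1 p.2) p :=
      (contMDiffAt_iff_contMDiffAt_nhds (by simp)).1 (hsmooth.of_le (n := ∞) (m := 1) (WithTop.coe_le_coe.2 le_top))
    filter_upwards [e1, cc.eventually hsrc, cc.eventually e3] with s a1 a2 a3
    have hd : MDifferentiableAt (𝓡 n) (𝓡 n) (h s) w.proj := by
      have a4 : ContMDiffAt (𝓡 n) (𝓡 n) 1 (h s) w.proj :=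
        ContMDiffAt.comp (f := fun q : Q => (s, q)) w.proj a3 (contMDiffAt_const.prodMk contMDiffAt_id)
      exact a4.mdifferentiableAt (by simp)
    have b1 : HasFDerivAt (fun x : EuclideanSpace ℝ (Fin n) => G (s, x)) ((fderiv ℝ G (s, x₀)).comp (ContinuousLinearMap.inr ℝ ℝ (EuclideanSpace ℝ (Fin n)))) x₀ :=
      HasFDerivAt.comp x₀ a1.hasFDerivAt (hasFDerivAt_prodMk_right s x₀)
    have b2 : HasMFDerivAt (𝓡 n) (𝓡 n) (fun q => G (s, e q)) w.proj
        (((fderiv ℝ G (s, x₀)).comp (ContinuousLinearMap.inr ℝ ℝ (EuclideanSpace ℝ (Fin n)))).comp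
          (mfderiv (𝓡 n) (𝓡 n) e w.proj)) :=
      HasMFDerivAt.comp (g := fun x => G (s, x)) (f := e) w.proj b1.hasMFDerivAt (mdifferentiableAt_chart hmem).hasMFDerivAt
    have b3 : HasMFDerivAt (𝓡 n) (𝓡 n) (fun q => e (h s q)) w.proj
        ((mfderiv (𝓡 n) (𝓡 n) e (h s w.proj)).comp (mfderiv (𝓡 n) (𝓡 n) (h s) w.proj)) :=
      HasMFDerivAt.comp w.proj (mdifferentiableAt_chart a2).hasMFDerivAt hd.hasMFDerivAt
    have b4 : (fun q => e (h s q)) =ᶠ[𝓝 w.proj] (fun q => G (s, e q)) := by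
      filter_upwards [e.open_source.mem_nhds hmem] with q hq
      simp only [G, e.left_inv hq]
    have b5 := hasMFDerivAt_unique b3 (b2.congr_of_eventuallyEq b4)
    have b6 : ∀ A, (mfderiv (𝓡 n) (𝓡 n) e w.proj (w.snd A) : EuclideanSpace ℝ (Fin n)) = w.snd A := fun A =>
      congrFun (congrArg Prod.snd (naturalCoords_eq w)) A
    rw [← naturalPoint_naturalCoords w.proj (canonicalProlongation (h s) w) a2]
    refine congrArg (naturalPoint e) (Prod.ext ?_ (funext fun A => ?_))
    · change e (h s w.proj) = e (h s (e.symm x₀))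
      rw [hesymm]
    · refine (congrArg (fun f : EuclideanSpace ℝ (Fin n) →L[ℝ] EuclideanSpace ℝ (Fin n) => f (w.snd A)) b5).trans ?_
      exact congrArg (fun u : EuclideanSpace ℝ (Fin n) => fderiv ℝ G (s, x₀) (0, u)) (b6 A)
  have h1 := hasDerivAt_flow_coords G x₀ (localComponents e Z) hG hX w.snd
  have h2 := mdifferentiableAt_naturalPoint w
  have h0 : (G (0, x₀), fun A => fderiv ℝ G (0, x₀) (0, w.snd A)) = naturalCoords e w := by
    rw [naturalCoords_eq]
    have b1 : HasFDerivAt (fun x : EuclideanSpace ℝ (Fin n) => G (0, x)) ((fderiv ℝ G (0, x₀)).comp (ContinuousLinearMap.inr ℝ ℝ (EuclideanSpace ℝ (Fin n)))) x₀ :=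
      HasFDerivAt.comp x₀ hGev.self_of_nhds.hasFDerivAt (hasFDerivAt_prodMk_right 0 x₀)
    have b2 : (fun x : EuclideanSpace ℝ (Fin n) => G (0, x)) =ᶠ[𝓝 x₀] id := by
      have : Tendsto e.symm (𝓝 x₀) (𝓝 w.proj) := by rw [← hesymm]; exact hsm
      filter_upwards [this.eventually hzero, e.open_target.mem_nhds (mem_chart_target _ _)] with x c1 c2
      simp only [G, c1, e.right_inv c2, id]
    have b3 := b1.unique ((hasFDerivAt_id x₀).congr_of_eventuallyEq b2)
    refine Prod.ext b2.self_of_nhds (funext fun A => ?_)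
    exact congrArg (fun f : EuclideanSpace ℝ (Fin n) →L[ℝ] EuclideanSpace ℝ (Fin n) => f (w.snd A)) b3
  have h3 : HasMFDerivAt 𝓘(ℝ, ℝ) 𝓘(ℝ, EuclideanSpace ℝ (Fin n) × (Fin k → EuclideanSpace ℝ (Fin n))) (fun s : ℝ => (G (s, x₀), fun A => fderiv ℝ G (s, x₀) (0, w.snd A))) 0 _ := h1.hasFDerivAt.hasMFDerivAt
  rw [← he, ← h0] at h2
  have h4 := HasMFDerivAt.comp (g := naturalPoint e) (0 : ℝ) h2.hasMFDerivAt h3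
  have h5 := h4.congr_of_eventuallyEq (f₁ := fun s => canonicalProlongation (h s) w) key
  have h6 : ∀ c, c = naturalCoords e w → ∀ u : EuclideanSpace ℝ (Fin n) × (Fin k → EuclideanSpace ℝ (Fin n)), (mfderiv 𝓘(ℝ, EuclideanSpace ℝ (Fin n) × (Fin k → EuclideanSpace ℝ (Fin n))) (velocityModel n k)
      (naturalPoint e : _ → Velocities n k Q) c u : EuclideanSpace ℝ (Fin n) × (Fin k → EuclideanSpace ℝ (Fin n))) = mfderiv 𝓘(ℝ, EuclideanSpace ℝ (Fin n) × (Fin k → EuclideanSpace ℝ (Fin n))) (velocityModel n k)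
      (naturalPoint e : _ → Velocities n k Q) (naturalCoords e w) u := by
    rintro _ rfl _; rfl
  have h7 : (naturalCoords e w).2 = w.snd := congrArg Prod.snd (naturalCoords_eq w)
  have h8 : (mfderiv 𝓘(ℝ, EuclideanSpace ℝ (Fin n) × (Fin k → EuclideanSpace ℝ (Fin n))) (velocityModel n k)
      (naturalPoint e : _ → Velocities n k Q) (G (0, x₀), fun A => (fderiv ℝ G (0, x₀)) (0, w.snd A))
      (localComponents e Z x₀, fun A => (fderiv ℝ (localComponents e Z) x₀) (w.snd A)) : EuclideanSpace ℝ (Fin n) × (Fin k → EuclideanSpace ℝ (Fin n))) =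
      completeLift Z w := by
    refine (h6 _ h0 _).trans ?_
    rw [← h7]
    rfl
  have h11 : ∀ (f : (EuclideanSpace ℝ (Fin n) × (Fin k → EuclideanSpace ℝ (Fin n))) →L[ℝ] (EuclideanSpace ℝ (Fin n) × (Fin k → EuclideanSpace ℝ (Fin n)))) (u c : EuclideanSpace ℝ (Fin n) × (Fin k → EuclideanSpace ℝ (Fin n))), f u = c →
      f.comp (ContinuousLinearMap.toSpanSingleton ℝ u) = (1 : ℝ →L[ℝ] ℝ).smulRight c := by
    rintro f u _ rfl
    refine ContinuousLinearMap.ext fun a => ?_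
    simp
  exact h5.congr_mfderiv (h11 _ _ _ h8)

end Flow

end KSymplectic

end

noncomputable section

namespace KSymplectic

/-! ### Smoothness in natural coordinates. -/

section Coordinates

variable {n k : ℕ} {Q : Type*} [TopologicalSpace Q]
  [ChartedSpace (EuclideanSpace ℝ (Fin n)) Q]

/-! The theorem follows from an identity that needs no symmetry: along a solution `φ`, the
divergence of the functions `Z^{V_A}(L) ∘ φ⁽¹⁾` equals `Z^C(L) ∘ φ⁽¹⁾`
(`sum_fderiv_verticalLift_prolongation`). If `Z^C(L) = 0`, the divergence vanishes.

In natural coordinates `Z^{V_A}(L) = Zⁱ ∂L/∂vⁱ_A`. Differentiating along `φ⁽¹⁾` in the direction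
`t^A` and summing over `A`, the product rule gives `Zⁱ ∑_A ∂/∂t^A (∂L/∂vⁱ_A)` plus `∑_A
(∂Zⁱ/∂qʲ)(∂φʲ/∂t^A) ∂L/∂vⁱ_A`. The Euler–Lagrange equations turn the first sum into `Zⁱ ∂L/∂qⁱ`; in
the second, `∂φʲ/∂t^A` is the coordinate `vʲ_A` of `φ⁽¹⁾`. The total is the coordinate expression of
`Z^C(L)`.

The formula for the vertical lift is differentiated in `t`, so it must hold in one fixed chart at
all nearby points (`lieDerivative_verticalLift`). The formula for the complete lift is only
evaluated at `φ⁽¹⁾(t)`, so the chart at `φ t`, which is the one in its definition, suffices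
(`lieDerivative_completeLift`). The same vertical formula, with the smoothness of `L` and `Z` in
coordinates, gives the smoothness of the conserved functions. -/

theorem naturalCoords_fst_mem_target {q : Q} {w : Velocities n k Q}
    (hw : w.proj ∈ (chartAt (EuclideanSpace ℝ (Fin n)) q).source) :
    (naturalCoords (chartAt (EuclideanSpace ℝ (Fin n)) q) w).1 ∈
      (chartAt (EuclideanSpace ℝ (Fin n)) q).target :=
  (chartAt (EuclideanSpace ℝ (Fin n)) q).map_source hw

variable [IsManifold (𝓡 n) ∞ Q]

/-- `naturalPoint` is the inverse of the bundle chart, and it also inverts `naturalCoords`; applying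
the bundle chart to both sides identifies the two coordinate systems. Smoothness of natural
coordinates is thereby inherited from the manifold structure of `T¹ₖQ`. -/
theorem naturalCoords_eq_extChartAt (w₀ : Velocities n k Q) {w : Velocities n k Q}
    (hw : w.proj ∈ (chartAt (EuclideanSpace ℝ (Fin n)) w₀.proj).source) :
    naturalCoords (chartAt (EuclideanSpace ℝ (Fin n)) w₀.proj) w =
      extChartAt (velocityModel n k) w₀ w := by
  have h1 := naturalPoint_eq w₀.proj w₀ rfl
    (naturalCoords (chartAt (EuclideanSpace ℝ (Fin n)) w₀.proj) w)
    (naturalCoords_fst_mem_target hw)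
  rw [naturalPoint_naturalCoords _ _ hw] at h1
  have h2 : naturalCoords (chartAt (EuclideanSpace ℝ (Fin n)) w₀.proj) w ∈
      (extChartAt (velocityModel n k) w₀).target := by
    rw [FiberBundle.extChartAt_target]
    have := naturalCoords_fst_mem_target hw
    simp only [mfld_simps]
    have h3 : (chartAt (EuclideanSpace ℝ (Fin n)) w₀.proj).symm
        (naturalCoords (chartAt (EuclideanSpace ℝ (Fin n)) w₀.proj) w).1 = w.proj :=
      (chartAt (EuclideanSpace ℝ (Fin n)) w₀.proj).left_inv hw
    refine ⟨this, ?_⟩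
    rw [h3]
    exact hw
  conv_rhs => rw [h1]
  exact ((extChartAt (velocityModel n k) w₀).right_inv h2).symm

theorem contMDiffAt_naturalCoords (w₀ : Velocities n k Q) :
    ContMDiffAt (velocityModel n k) 𝓘(ℝ, EuclideanSpace ℝ (Fin n) × (Fin k → EuclideanSpace ℝ (Fin n)))
      ∞ (naturalCoords (chartAt (EuclideanSpace ℝ (Fin n)) w₀.proj)) w₀ := by
  refine (contMDiffAt_extChartAt (I := velocityModel n k) (x := w₀) (n := ∞)).congr_of_eventuallyEq ?_
  have hc : Continuous (fun w : Velocities n k Q => w.proj) :=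
    FiberBundle.continuous_proj (Fin k → EuclideanSpace ℝ (Fin n)) (VelocityFiber n k : Q → Type)
  filter_upwards [((chartAt (EuclideanSpace ℝ (Fin n)) w₀.proj).open_source.preimage hc).mem_nhds
    (mem_chart_source _ w₀.proj)] with w hw
  exact naturalCoords_eq_extChartAt w₀ hw

theorem contMDiffAt_naturalPoint (q : Q)
    {x : EuclideanSpace ℝ (Fin n) × (Fin k → EuclideanSpace ℝ (Fin n))}
    (hx : x.1 ∈ (chartAt (EuclideanSpace ℝ (Fin n)) q).target) :
    ContMDiffAt 𝓘(ℝ, EuclideanSpace ℝ (Fin n) × (Fin k → EuclideanSpace ℝ (Fin n)))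
      (velocityModel n k) ∞
      (naturalPoint (chartAt (EuclideanSpace ℝ (Fin n)) q) : _ → Velocities n k Q) x := by
  -- The bundle chart at a point depends only on its projection, so the zero velocity over `q`
  -- serves as centre.
  let w₀ : Velocities n k Q := ⟨q, 0⟩
  have hmem : (Prod.fst ⁻¹' (chartAt (EuclideanSpace ℝ (Fin n)) q).target :
      Set (EuclideanSpace ℝ (Fin n) × (Fin k → EuclideanSpace ℝ (Fin n)))) ∈ 𝓝 x :=
    ((chartAt (EuclideanSpace ℝ (Fin n)) q).open_target.preimage continuous_fst).mem_nhds hx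
  have ht : (extChartAt (velocityModel n k) w₀).target ∈ 𝓝 x := by
    filter_upwards [hmem] with y hy
    rw [FiberBundle.extChartAt_target]
    simp only [mfld_simps]
    exact ⟨hy, (chartAt (EuclideanSpace ℝ (Fin n)) q).map_target hy⟩
  refine ((contMDiffOn_extChartAt_symm (I := velocityModel n k) (n := ∞) w₀).contMDiffAt ht
    ).congr_of_eventuallyEq ?_
  filter_upwards [hmem] with y hy
  exact naturalPoint_eq q w₀ rfl y hy

theorem contDiffAt_comp_naturalPoint {L : Velocities n k Q → ℝ}
    (hL : ContMDiff (velocityModel n k) 𝓘(ℝ, ℝ) ∞ L) (q : Q)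
    {x : EuclideanSpace ℝ (Fin n) × (Fin k → EuclideanSpace ℝ (Fin n))}
    (hx : x.1 ∈ (chartAt (EuclideanSpace ℝ (Fin n)) q).target) :
    ContDiffAt ℝ ∞ (fun y => L (naturalPoint (chartAt (EuclideanSpace ℝ (Fin n)) q) y)) x :=
  (hL.contMDiffAt.comp x (contMDiffAt_naturalPoint q hx)).contDiffAt

/-- On the chart domain the differential of the chart is the fibre part of the tangent bundle
trivialization, so the components of `Z` are the smooth section `Z` read in that trivialization and
composed with the inverse chart. -/
theorem contDiffAt_localComponents {Z : ∀ q : Q, TangentSpace (𝓡 n) q}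
    (hZ : ContMDiff (𝓡 n) (𝓡 n).tangent ∞ (fun q => (⟨q, Z q⟩ : TangentBundle (𝓡 n) Q))) (q : Q)
    {x : EuclideanSpace ℝ (Fin n)} (hx : x ∈ (chartAt (EuclideanSpace ℝ (Fin n)) q).target) :
    ContDiffAt ℝ ∞ (localComponents (chartAt (EuclideanSpace ℝ (Fin n)) q) Z) x := by
  -- The tangent bundle is one degree less smooth than its base; at `∞` nothing is lost, since `∞ +
  -- 1` reduces to `∞`.
  have : IsManifold (𝓡 n) (∞ + 1) Q := ‹IsManifold (𝓡 n) ∞ Q›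
  have : ContMDiffVectorBundle ∞ (EuclideanSpace ℝ (Fin n)) (TangentSpace (𝓡 n) : Q → Type _)
    (𝓡 n) := TangentBundle.contMDiffVectorBundle
  set e := chartAt (EuclideanSpace ℝ (Fin n)) q with he
  let τ := trivializationAt (EuclideanSpace ℝ (Fin n)) (TangentSpace (𝓡 n)) q
  have hsrc : e.symm x ∈ e.source := e.map_target hx
  have h1 : ContMDiffAt (𝓡 n) 𝓘(ℝ, EuclideanSpace ℝ (Fin n)) ∞ (fun p => (τ ⟨p, Z p⟩).2)
      (e.symm x) :=
    (τ.contMDiffAt_section_iff (s := Z) hsrc).1 hZ.contMDiffAt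
  have h2 : ContMDiffAt (𝓡 n) (𝓡 n) ∞ e.symm x :=
    (contMDiffOn_symm_of_mem_maximalAtlas (IsManifold.chart_mem_maximalAtlas _)).contMDiffAt
      (e.open_target.mem_nhds hx)
  refine ((ContMDiffAt.comp x h1 h2).contDiffAt).congr_of_eventuallyEq ?_
  filter_upwards [e.open_target.mem_nhds hx] with y hy
  have h3 := TangentBundle.continuousLinearMapAt_trivializationAt (I := 𝓡 n) (x₀ := q)
    (x := e.symm y) (e.map_target hy)
  have h4 : (mfderiv (𝓡 n) (𝓡 n) e (e.symm y) : EuclideanSpace ℝ (Fin n) →L[ℝ] EuclideanSpace ℝ (Fin n))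
      = τ.continuousLinearMapAt ℝ (e.symm y) := by
    refine Eq.trans ?_ h3.symm
    simp [extChartAt, OpenPartialHomeomorph.extend]
    rfl
  refine (congrArg (fun f : EuclideanSpace ℝ (Fin n) →L[ℝ] EuclideanSpace ℝ (Fin n) =>
    f (Z (e.symm y))) h4).trans ?_
  exact τ.continuousLinearMapAt_apply_of_mem ℝ (e.map_target hy) (Z (e.symm y))

end Coordinates

/-! ### Lie derivatives along the lifts, in coordinates. -/

section Lifts

variable {n k : ℕ} {Q : Type*} [TopologicalSpace Q]
  [ChartedSpace (EuclideanSpace ℝ (Fin n)) Q]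

/-- The differential of the chart is linear on the fibre, so the curve defining the vertical lift
becomes a straight line in coordinates. -/
theorem naturalCoords_vertical (q : Q) {w : Velocities n k Q}
    (hw : w.proj ∈ (chartAt (EuclideanSpace ℝ (Fin n)) q).source)
    (Z : ∀ q : Q, TangentSpace (𝓡 n) q) (A : Fin k) (s : ℝ) :
    naturalCoords (chartAt (EuclideanSpace ℝ (Fin n)) q)
      (⟨w.proj, Function.update w.snd A (w.snd A + s • Z w.proj)⟩ : Velocities n k Q) =
    naturalCoords (chartAt (EuclideanSpace ℝ (Fin n)) q) w +
      s • ((0 : EuclideanSpace ℝ (Fin n)), (Pi.single A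
        (localComponents (chartAt (EuclideanSpace ℝ (Fin n)) q) Z
          (naturalCoords (chartAt (EuclideanSpace ℝ (Fin n)) q) w).1) :
            Fin k → EuclideanSpace ℝ (Fin n))) := by
  set e := chartAt (EuclideanSpace ℝ (Fin n)) q
  have hX : localComponents e Z (naturalCoords e w).1 =
      (mfderiv (𝓡 n) (𝓡 n) e w.proj (Z w.proj) : EuclideanSpace ℝ (Fin n)) := by
    -- `e.symm (e p) = p` is not definitional and the type of `Z` depends on the point, so the
    -- equality is generalised before substitution. The same device recurs below.
    have : ∀ q' : Q, q' = w.proj → (mfderiv (𝓡 n) (𝓡 n) e q' (Z q') : EuclideanSpace ℝ (Fin n)) =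
      mfderiv (𝓡 n) (𝓡 n) e w.proj (Z w.proj) := by rintro _ rfl; rfl
    exact this _ (e.left_inv hw)
  rw [hX]
  refine Prod.ext ?_ (funext fun B => ?_)
  · change e w.proj = e w.proj + s • (0 : EuclideanSpace ℝ (Fin n))
    simp
  · have key : ∀ (T : EuclideanSpace ℝ (Fin n) →L[ℝ] EuclideanSpace ℝ (Fin n))
        (v : Fin k → EuclideanSpace ℝ (Fin n)) (z : EuclideanSpace ℝ (Fin n)),
        T (Function.update v A (v A + s • z) B) =
          T (v B) + s • (Pi.single A (T z) : Fin k → EuclideanSpace ℝ (Fin n)) B := by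
      intro T v z
      by_cases h : B = A
      · subst h; simp
      · simp [h]
    exact key (mfderiv (𝓡 n) (𝓡 n) e w.proj) w.snd (Z w.proj)

variable [IsManifold (𝓡 n) ∞ Q]

/-- The chain rule for `L ∘ naturalPoint`: it turns derivatives along vectors given by coordinates
into ordinary Fréchet derivatives. -/
theorem mfderiv_naturalPoint_apply {L : Velocities n k Q → ℝ}
    (hL : ContMDiff (velocityModel n k) 𝓘(ℝ, ℝ) ∞ L) (q : Q) {w : Velocities n k Q}
    (hw : w.proj ∈ (chartAt (EuclideanSpace ℝ (Fin n)) q).source)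
    (u : EuclideanSpace ℝ (Fin n) × (Fin k → EuclideanSpace ℝ (Fin n))) :
    (mfderiv (velocityModel n k) 𝓘(ℝ, ℝ) L w :
        EuclideanSpace ℝ (Fin n) × (Fin k → EuclideanSpace ℝ (Fin n)) →L[ℝ] ℝ)
      (mfderiv 𝓘(ℝ, EuclideanSpace ℝ (Fin n) × (Fin k → EuclideanSpace ℝ (Fin n)))
        (velocityModel n k)
        (naturalPoint (chartAt (EuclideanSpace ℝ (Fin n)) q) : _ → Velocities n k Q)
        (naturalCoords (chartAt (EuclideanSpace ℝ (Fin n)) q) w) u) =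
      fderiv ℝ (fun x => L (naturalPoint (chartAt (EuclideanSpace ℝ (Fin n)) q) x))
        (naturalCoords (chartAt (EuclideanSpace ℝ (Fin n)) q) w) u := by
  set e := chartAt (EuclideanSpace ℝ (Fin n)) q
  have hpt : naturalPoint e (naturalCoords e w) = w := naturalPoint_naturalCoords q w hw
  have h1 : MDifferentiableAt (velocityModel n k) 𝓘(ℝ, ℝ) L (naturalPoint e (naturalCoords e w)) :=
    hL.contMDiffAt.mdifferentiableAt (by simp)
  have h2 : MDifferentiableAt 𝓘(ℝ, EuclideanSpace ℝ (Fin n) × (Fin k → EuclideanSpace ℝ (Fin n)))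
      (velocityModel n k) (naturalPoint e : _ → Velocities n k Q) (naturalCoords e w) :=
    (contMDiffAt_naturalPoint q (naturalCoords_fst_mem_target hw)).mdifferentiableAt (by simp)
  have h3 := h1.hasMFDerivAt.comp (naturalCoords e w) h2.hasMFDerivAt
  have h3' := mfderiv_eq_fderiv.symm.trans h3.mfderiv
  have h4 : ∀ w' : Velocities n k Q, w' = w →
      ∀ c : EuclideanSpace ℝ (Fin n) × (Fin k → EuclideanSpace ℝ (Fin n)),
      (mfderiv (velocityModel n k) 𝓘(ℝ, ℝ) L w' :
        EuclideanSpace ℝ (Fin n) × (Fin k → EuclideanSpace ℝ (Fin n)) →L[ℝ] ℝ) c =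
      (mfderiv (velocityModel n k) 𝓘(ℝ, ℝ) L w :
        EuclideanSpace ℝ (Fin n) × (Fin k → EuclideanSpace ℝ (Fin n)) →L[ℝ] ℝ) c := by
    rintro _ rfl _; rfl
  refine (h4 _ hpt _).symm.trans ?_
  exact (congrArg (fun f : EuclideanSpace ℝ (Fin n) × (Fin k → EuclideanSpace ℝ (Fin n)) →L[ℝ] ℝ =>
    f u) h3').symm

theorem lieDerivative_completeLift {L : Velocities n k Q → ℝ}
    (hL : ContMDiff (velocityModel n k) 𝓘(ℝ, ℝ) ∞ L) (Z : ∀ q : Q, TangentSpace (𝓡 n) q)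
    (w : Velocities n k Q) :
    lieDerivative (completeLift Z) L w =
      fderiv ℝ (fun x => L (naturalPoint (chartAt (EuclideanSpace ℝ (Fin n)) w.proj) x))
        (naturalCoords (chartAt (EuclideanSpace ℝ (Fin n)) w.proj) w)
        (localComponents (chartAt (EuclideanSpace ℝ (Fin n)) w.proj) Z
            (naturalCoords (chartAt (EuclideanSpace ℝ (Fin n)) w.proj) w).1,
          fun A => fderiv ℝ (localComponents (chartAt (EuclideanSpace ℝ (Fin n)) w.proj) Z)
            (naturalCoords (chartAt (EuclideanSpace ℝ (Fin n)) w.proj) w).1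
            ((naturalCoords (chartAt (EuclideanSpace ℝ (Fin n)) w.proj) w).2 A)) :=
  mfderiv_naturalPoint_apply hL w.proj (mem_chart_source _ _) _

/-- The vertical curve is the `naturalPoint` image of a line with direction `u`, so its velocity is
the image of `u`. The chart may be centred at any `q` whose chart domain contains the base point,
which allows `w` to vary with the chart fixed. -/
theorem lieDerivative_verticalLift {L : Velocities n k Q → ℝ}
    (hL : ContMDiff (velocityModel n k) 𝓘(ℝ, ℝ) ∞ L) (Z : ∀ q : Q, TangentSpace (𝓡 n) q)
    (A : Fin k) (q : Q) {w : Velocities n k Q}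
    (hw : w.proj ∈ (chartAt (EuclideanSpace ℝ (Fin n)) q).source) :
    lieDerivative (verticalLift Z A) L w =
      fderiv ℝ (fun x => L (naturalPoint (chartAt (EuclideanSpace ℝ (Fin n)) q) x))
        (naturalCoords (chartAt (EuclideanSpace ℝ (Fin n)) q) w)
        (0, Pi.single A (localComponents (chartAt (EuclideanSpace ℝ (Fin n)) q) Z
          (naturalCoords (chartAt (EuclideanSpace ℝ (Fin n)) q) w).1)) := by
  rw [← mfderiv_naturalPoint_apply hL q hw]
  set e := chartAt (EuclideanSpace ℝ (Fin n)) q with he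
  set c := naturalCoords e w with hc
  set u : EuclideanSpace ℝ (Fin n) × (Fin k → EuclideanSpace ℝ (Fin n)) :=
    (0, Pi.single A (localComponents e Z c.1)) with hu
  refine congrArg (mfderiv (velocityModel n k) 𝓘(ℝ, ℝ) L w :
        EuclideanSpace ℝ (Fin n) × (Fin k → EuclideanSpace ℝ (Fin n)) →L[ℝ] ℝ) ?_
  have hcurve : (fun s : ℝ => (⟨w.proj, Function.update w.snd A (w.snd A + s • Z w.proj)⟩ :
      Velocities n k Q)) = fun s => naturalPoint e (c + s • u) := by
    funext s
    rw [hc, hu, ← naturalCoords_vertical q hw Z A s]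
    exact (naturalPoint_naturalCoords q (⟨w.proj, Function.update w.snd A (w.snd A + s • Z w.proj)⟩ :
      Velocities n k Q) hw).symm
  have hline : HasDerivAt (fun s : ℝ => c + s • u) u 0 := by
    simpa using ((hasDerivAt_id (0 : ℝ)).smul_const u).const_add c
  have h0 : c + (0 : ℝ) • u = c := by simp
  have h2 : MDifferentiableAt 𝓘(ℝ, EuclideanSpace ℝ (Fin n) × (Fin k → EuclideanSpace ℝ (Fin n)))
      (velocityModel n k) (naturalPoint e : _ → Velocities n k Q) (c + (0 : ℝ) • u) := by
    rw [h0]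
    exact (contMDiffAt_naturalPoint q (naturalCoords_fst_mem_target hw)).mdifferentiableAt (by simp)
  have h3 := (h2.hasMFDerivAt.comp (f := fun s : ℝ => c + s • u) (0 : ℝ)
    hline.hasFDerivAt.hasMFDerivAt).mfderiv
  have h4 : ∀ c', c' = c → ∀ v : EuclideanSpace ℝ (Fin n) × (Fin k → EuclideanSpace ℝ (Fin n)),
      (mfderiv 𝓘(ℝ, EuclideanSpace ℝ (Fin n) × (Fin k → EuclideanSpace ℝ (Fin n)))
        (velocityModel n k) (naturalPoint e : _ → Velocities n k Q) c' v :
          EuclideanSpace ℝ (Fin n) × (Fin k → EuclideanSpace ℝ (Fin n))) =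
      mfderiv 𝓘(ℝ, EuclideanSpace ℝ (Fin n) × (Fin k → EuclideanSpace ℝ (Fin n)))
        (velocityModel n k) (naturalPoint e : _ → Velocities n k Q) c v := by
    rintro _ rfl _; rfl
  have h5 : ∀ γ : ℝ → Velocities n k Q, γ = (fun s : ℝ => naturalPoint e (c + s • u)) →
      (mfderiv 𝓘(ℝ, ℝ) (velocityModel n k) γ 0 (1 : ℝ) :
        EuclideanSpace ℝ (Fin n) × (Fin k → EuclideanSpace ℝ (Fin n))) =
      mfderiv 𝓘(ℝ, ℝ) (velocityModel n k) (fun s : ℝ => naturalPoint e (c + s • u)) 0 (1 : ℝ) := by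
    rintro _ rfl; rfl
  refine (h5 _ hcurve).trans ?_
  refine Eq.trans ?_ (h4 _ h0 u)
  refine (congrArg (fun f : ℝ →L[ℝ] EuclideanSpace ℝ (Fin n) × (Fin k → EuclideanSpace ℝ (Fin n)) =>
    f 1) h3).trans ?_
  have h6 : ∀ f : (EuclideanSpace ℝ (Fin n) × (Fin k → EuclideanSpace ℝ (Fin n))) →L[ℝ]
      (EuclideanSpace ℝ (Fin n) × (Fin k → EuclideanSpace ℝ (Fin n))),
      f.comp (ContinuousLinearMap.toSpanSingleton ℝ u) 1 = f u := by intro f; simp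
  exact h6 _

/-- Near `w₀`, in one fixed chart, the function is the derivative of the coordinate Lagrangian
applied to a direction built from the components of `Z`; both depend smoothly on the coordinates. -/
theorem contMDiff_lieDerivative_verticalLift {L : Velocities n k Q → ℝ}
    (hL : ContMDiff (velocityModel n k) 𝓘(ℝ, ℝ) ∞ L) {Z : ∀ q : Q, TangentSpace (𝓡 n) q}
    (hZ : ContMDiff (𝓡 n) (𝓡 n).tangent ∞ (fun q => (⟨q, Z q⟩ : TangentBundle (𝓡 n) Q)))
    (A : Fin k) :
    ContMDiff (velocityModel n k) 𝓘(ℝ, ℝ) ∞ (lieDerivative (verticalLift Z A) L) := by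
  intro w₀
  set e := chartAt (EuclideanSpace ℝ (Fin n)) w₀.proj with he
  have hw₀ : w₀.proj ∈ e.source := mem_chart_source _ _
  have ht : (naturalCoords e w₀).1 ∈ e.target := naturalCoords_fst_mem_target hw₀
  have h1 : ContDiffAt ℝ ∞ (fun x => L (naturalPoint e x)) (naturalCoords e w₀) :=
    contDiffAt_comp_naturalPoint hL w₀.proj ht
  have h2 : ContDiffAt ℝ ∞ (localComponents e Z) (naturalCoords e w₀).1 :=
    contDiffAt_localComponents hZ w₀.proj ht
  have h3 : ContDiffAt ℝ ∞
      (fun x : EuclideanSpace ℝ (Fin n) × (Fin k → EuclideanSpace ℝ (Fin n)) =>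
        ((0 : EuclideanSpace ℝ (Fin n)),
          (Pi.single A (localComponents e Z x.1) : Fin k → EuclideanSpace ℝ (Fin n))))
      (naturalCoords e w₀) :=
    contDiffAt_const.prodMk
      ((ContinuousLinearMap.single ℝ (fun _ : Fin k => EuclideanSpace ℝ (Fin n)) A).contDiff.contDiffAt.comp
        _ (h2.comp _ contDiffAt_fst))
  have h4 := (h1.fderiv_right (m := ∞) le_rfl).clm_apply h3
  refine (ContMDiffAt.comp w₀ h4.contMDiffAt (contMDiffAt_naturalCoords w₀)).congr_of_eventuallyEq ?_
  have hc : Continuous (fun w : Velocities n k Q => w.proj) :=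
    FiberBundle.continuous_proj (Fin k → EuclideanSpace ℝ (Fin n)) (VelocityFiber n k : Q → Type)
  filter_upwards [(e.open_source.preimage hc).mem_nhds hw₀] with w hw
  exact lieDerivative_verticalLift hL Z A w₀.proj hw

end Lifts

/-! ### The divergence identity along solutions. -/

section Noether

variable {n k : ℕ} {Q : Type*} [TopologicalSpace Q]
  [ChartedSpace (EuclideanSpace ℝ (Fin n)) Q]

theorem euclidean_eq_sum_single (x : EuclideanSpace ℝ (Fin n)) :
    x = ∑ i, x i • (EuclideanSpace.single i (1 : ℝ) : EuclideanSpace ℝ (Fin n)) := by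
  ext j
  simp [Finset.sum_apply, Pi.single_apply]

theorem fderiv_vertical_eq_sum (e : OpenPartialHomeomorph Q (EuclideanSpace ℝ (Fin n)))
    (L : Velocities n k Q → ℝ) (A : Fin k) (w : Velocities n k Q) (z : EuclideanSpace ℝ (Fin n)) :
    fderiv ℝ (fun x => L (naturalPoint e x)) (naturalCoords e w) (0, Pi.single A z) =
      ∑ i, z i * partialV e L A i w := by
  have h := congrArg (fun z => ((fderiv ℝ (fun x => L (naturalPoint e x)) (naturalCoords e w)).comp
    ((ContinuousLinearMap.inr ℝ (EuclideanSpace ℝ (Fin n)) (Fin k → EuclideanSpace ℝ (Fin n))).comp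
      (ContinuousLinearMap.single ℝ (fun _ : Fin k => EuclideanSpace ℝ (Fin n)) A))) z)
    (euclidean_eq_sum_single z)
  simp only [map_sum, map_smul, smul_eq_mul] at h
  exact h

theorem fderiv_horizontal_eq_sum (e : OpenPartialHomeomorph Q (EuclideanSpace ℝ (Fin n)))
    (L : Velocities n k Q → ℝ) (w : Velocities n k Q) (z : EuclideanSpace ℝ (Fin n)) :
    fderiv ℝ (fun x => L (naturalPoint e x)) (naturalCoords e w) (z, 0) =
      ∑ i, z i * partialQ e L i w := by
  have h := congrArg (fun z => ((fderiv ℝ (fun x => L (naturalPoint e x)) (naturalCoords e w)).comp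
    (ContinuousLinearMap.inl ℝ (EuclideanSpace ℝ (Fin n)) (Fin k → EuclideanSpace ℝ (Fin n)))) z)
    (euclidean_eq_sum_single z)
  simp only [map_sum, map_smul, smul_eq_mul] at h
  exact h

/-- Only linearity of the Fréchet derivative is involved, so no differentiability of `L` is needed.
-/
theorem fderiv_naturalPoint_apply_eq_sum (e : OpenPartialHomeomorph Q (EuclideanSpace ℝ (Fin n)))
    (L : Velocities n k Q → ℝ) (w : Velocities n k Q) (z : EuclideanSpace ℝ (Fin n))
    (v : Fin k → EuclideanSpace ℝ (Fin n)) :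
    fderiv ℝ (fun x => L (naturalPoint e x)) (naturalCoords e w) (z, v) =
      ∑ i, z i * partialQ e L i w + ∑ A, ∑ i, v A i * partialV e L A i w := by
  have hv : (z, v) = (z, (0 : Fin k → EuclideanSpace ℝ (Fin n))) +
      ∑ A, ((0 : EuclideanSpace ℝ (Fin n)), (Pi.single A (v A) : Fin k → EuclideanSpace ℝ (Fin n))) := by
    refine Prod.ext ?_ ?_
    · simp [Prod.fst_sum]
    · simp [Prod.snd_sum, Finset.univ_sum_single]
  rw [hv, map_add, map_sum, fderiv_horizontal_eq_sum]
  simp only [fderiv_vertical_eq_sum]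

variable [IsManifold (𝓡 n) ∞ Q]

/-- By the chain rule the velocity coordinates of `φ⁽¹⁾` are the partial derivatives of the
coordinate expression of `φ`. -/
theorem naturalCoords_prolongation (q : Q) {φ : EuclideanSpace ℝ (Fin k) → Q}
    {s : EuclideanSpace ℝ (Fin k)} (hφ : MDifferentiableAt (𝓡 k) (𝓡 n) φ s)
    (hs : φ s ∈ (chartAt (EuclideanSpace ℝ (Fin n)) q).source) :
    naturalCoords (chartAt (EuclideanSpace ℝ (Fin n)) q) (prolongation φ s) =
      (chartAt (EuclideanSpace ℝ (Fin n)) q (φ s), fun A =>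
        fderiv ℝ (fun r => chartAt (EuclideanSpace ℝ (Fin n)) q (φ r)) s
          (EuclideanSpace.single A 1)) := by
  have h' := (mdifferentiableAt_chart hs).hasMFDerivAt.comp s hφ.hasMFDerivAt
  have h := mfderiv_eq_fderiv.symm.trans h'.mfderiv
  refine Prod.ext rfl (funext fun A => ?_)
  exact (congrArg (fun f : EuclideanSpace ℝ (Fin k) →L[ℝ] EuclideanSpace ℝ (Fin n) =>
    f (EuclideanSpace.single A 1)) h).symm

/-- The product rule for `Zⁱ ∂L/∂vⁱ_A` along `φ⁽¹⁾`, followed by the Euler–Lagrange equations; this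
is where `φ` being a solution enters. -/
theorem sum_fderiv_verticalLift_prolongation {L : Velocities n k Q → ℝ}
    (hL : ContMDiff (velocityModel n k) 𝓘(ℝ, ℝ) ∞ L) {Z : ∀ q : Q, TangentSpace (𝓡 n) q}
    (hZ : ContMDiff (𝓡 n) (𝓡 n).tangent ∞ (fun q => (⟨q, Z q⟩ : TangentBundle (𝓡 n) Q)))
    {U : Set (EuclideanSpace ℝ (Fin k))} (hU : IsOpen U) {φ : EuclideanSpace ℝ (Fin k) → Q}
    (hφ : IsEulerLagrangeSolutionOn L φ U) {t : EuclideanSpace ℝ (Fin k)} (ht : t ∈ U) :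
    ∑ A : Fin k, fderiv ℝ (fun s => lieDerivative (verticalLift Z A) L (prolongation φ s)) t
      (EuclideanSpace.single A 1) = lieDerivative (completeLift Z) L (prolongation φ t) := by
  set e := chartAt (EuclideanSpace ℝ (Fin n)) (φ t) with he
  have hsrc : φ t ∈ e.source := mem_chart_source _ _
  have hφt : ContMDiffAt (𝓡 k) (𝓡 n) ∞ φ t := hφ.smooth.contMDiffAt (hU.mem_nhds ht)
  -- Derivatives at `t` see a neighbourhood of `t`, so the coordinate formulas are needed at all
  -- nearby `s`, in the chart at `φ t`.
  have hnear : ∀ᶠ s in 𝓝 t, MDifferentiableAt (𝓡 k) (𝓡 n) φ s ∧ φ s ∈ e.source := by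
    filter_upwards [hU.mem_nhds ht, hφt.continuousAt.eventually_mem (e.open_source.mem_nhds hsrc)]
      with s hs hs'
    exact ⟨(hφ.smooth.contMDiffAt (hU.mem_nhds hs)).mdifferentiableAt (by simp), hs'⟩
  set ψ : EuclideanSpace ℝ (Fin k) → EuclideanSpace ℝ (Fin n) := fun s => e (φ s) with hψdef
  have hψ : ContDiffAt ℝ ∞ ψ t := by
    have h2 : ContMDiffAt (𝓡 n) (𝓡 n) ∞ e (φ t) :=
      contMDiffAt_of_mem_maximalAtlas (IsManifold.chart_mem_maximalAtlas _) hsrc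
    exact (h2.comp t hφt).contDiffAt
  have hcoord : ∀ᶠ s in 𝓝 t, naturalCoords e (prolongation φ s) =
      (ψ s, fun A => fderiv ℝ ψ s (EuclideanSpace.single A 1)) :=
    hnear.mono fun s hs => naturalCoords_prolongation (φ t) hs.1 hs.2
  have hC : DifferentiableAt ℝ (fun s => naturalCoords e (prolongation φ s)) t := by
    refine DifferentiableAt.congr_of_eventuallyEq ?_ hcoord
    refine (hψ.differentiableAt (by simp)).prodMk (differentiableAt_pi.2 fun A => ?_)
    exact ((hψ.fderiv_right (m := ∞) le_rfl).differentiableAt (by simp)).clm_apply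
      (differentiableAt_const _)
  have htgt : (naturalCoords e (prolongation φ t)).1 ∈ e.target :=
    naturalCoords_fst_mem_target (w := prolongation φ t) hsrc
  have hℓ : DifferentiableAt ℝ (fderiv ℝ fun x => L (naturalPoint e x))
      (naturalCoords e (prolongation φ t)) :=
    ((contDiffAt_comp_naturalPoint hL (φ t) htgt).fderiv_right (m := ∞) le_rfl).differentiableAt
      (by simp)
  -- The product rule requires the momenta to be genuinely differentiable along `φ⁽¹⁾`: they compose
  -- the smooth derivative of the coordinate Lagrangian with `(ψ, ∂ψ)`.
  have hp : ∀ A i, DifferentiableAt ℝ (fun s => partialV e L A i (prolongation φ s)) t := fun A i =>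
    (DifferentiableAt.fun_comp' t hℓ hC).clm_apply (differentiableAt_const _)
  have hX : HasFDerivAt (fun s => localComponents e Z (ψ s))
      ((fderiv ℝ (localComponents e Z) (ψ t)).comp (fderiv ℝ ψ t)) t :=
    HasFDerivAt.comp (g := localComponents e Z) (f := ψ) t ((contDiffAt_localComponents hZ (φ t) htgt).differentiableAt
      (by simp)).hasFDerivAt (hψ.differentiableAt (by simp)).hasFDerivAt
  have hXi : ∀ i, HasFDerivAt (fun s => localComponents e Z (ψ s) i)
      ((EuclideanSpace.proj i).comp
        ((fderiv ℝ (localComponents e Z) (ψ t)).comp (fderiv ℝ ψ t))) t := fun i =>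
    (EuclideanSpace.proj (𝕜 := ℝ) i).hasFDerivAt.comp t hX
  have hf : ∀ A, fderiv ℝ (fun s => lieDerivative (verticalLift Z A) L (prolongation φ s)) t
      (EuclideanSpace.single A 1) =
      ∑ i, (localComponents e Z (ψ t) i *
          fderiv ℝ (fun s => partialV e L A i (prolongation φ s)) t (EuclideanSpace.single A 1) +
        (fderiv ℝ (localComponents e Z) (ψ t) (fderiv ℝ ψ t (EuclideanSpace.single A 1))) i *
          partialV e L A i (prolongation φ t)) := by
    intro A
    have h1 : (fun s => lieDerivative (verticalLift Z A) L (prolongation φ s)) =ᶠ[𝓝 t]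
        fun s => ∑ i, localComponents e Z (ψ s) i * partialV e L A i (prolongation φ s) := by
      filter_upwards [hnear] with s hs
      rw [lieDerivative_verticalLift hL Z A (φ t) (w := prolongation φ s) hs.2]
      exact fderiv_vertical_eq_sum e L A _ _
    have h2 := HasFDerivAt.fun_sum (u := Finset.univ) fun i _ => (hXi i).fun_mul (hp A i).hasFDerivAt
    rw [h1.fderiv_eq, h2.fderiv, sum_apply]
    refine Finset.sum_congr rfl fun i _ => ?_
    simp [mul_comm]
  have hEL := hφ.equations e (IsManifold.chart_mem_maximalAtlas _) t ht hsrc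
  rw [lieDerivative_completeLift hL Z (prolongation φ t)]
  -- The base point of `φ⁽¹⁾(t)` is `φ t` by definition, so the chart used by the complete lift is
  -- `e`.
  change _ = fderiv ℝ (fun x => L (naturalPoint e x)) (naturalCoords e (prolongation φ t)) _
  rw [fderiv_naturalPoint_apply_eq_sum]
  change _ = ∑ i, localComponents e Z (naturalCoords e (prolongation φ t)).1 i * _ +
    ∑ A, ∑ i, (fderiv ℝ (localComponents e Z) (naturalCoords e (prolongation φ t)).1
      ((naturalCoords e (prolongation φ t)).2 A)) i * _
  -- Replaces `v_A` by `∂ψ/∂t^A`, after which the terms containing the derivative of `Z` are the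
  -- same on both sides.
  rw [hcoord.self_of_nhds]
  simp only [hf, Finset.sum_add_distrib]
  congr 1
  -- What remains, for each `i`, is the Euler–Lagrange equation multiplied by `Zⁱ`.
  rw [Finset.sum_comm]
  refine Finset.sum_congr rfl fun i _ => ?_
  rw [← Finset.mul_sum, hEL i]

end Noether
end KSymplectic

end

theorem mainTheorem7 {n k : ℕ} {Q : Type*} [TopologicalSpace Q]
    [ChartedSpace (EuclideanSpace ℝ (Fin n)) Q] [IsManifold (𝓡 n) ∞ Q]
    (L : KSymplectic.Velocities n k Q → ℝ)
    (hL : ContMDiff (KSymplectic.velocityModel n k) 𝓘(ℝ, ℝ) ∞ L)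
    (Y : ∀ w : KSymplectic.Velocities n k Q, TangentSpace (KSymplectic.velocityModel n k) w)
    (Z : ∀ q : Q, TangentSpace (𝓡 n) q)
    (hZ : ContMDiff (𝓡 n) (𝓡 n).tangent ∞ (fun q => (⟨q, Z q⟩ : TangentBundle (𝓡 n) Q)))
    (hYZ : Y = KSymplectic.completeLift Z)
    (hY : KSymplectic.IsInfinitesimalStrictSymmetry L Y) :
    KSymplectic.IsConservationLaw L
      (fun A => KSymplectic.lieDerivative (KSymplectic.verticalLift Z A) L) := by
  subst hYZ
  -- The symmetry `hY` enters only here, to annihilate the right side of the divergence identity.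
  exact ⟨fun A => KSymplectic.contMDiff_lieDerivative_verticalLift hL hZ A, fun U hU φ hφ t ht =>
    (KSymplectic.sum_fderiv_verticalLift_prolongation hL hZ hU hφ ht).trans (hY _)⟩
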